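/- Let $K$ be a field and $q\in K$, $q\neq 0$. The pop-switch planar algebra $\mathcal{PSPA}$ is the planar algebra over $K$ spanned by planar isotopy classes of crossingless diagrams of oriented strands (with arbitrary directions at the boundary points), modulo the following local relations. Write $\uparrow,\downarrow$ for vertical strands, $\circlearrowleft,\circlearrowright$ for a counterclockwise and a clockwise circle, $x\otimes y$ for $x$ drawn to the left of $y$, and $xy$ for $x$ drawn on top of $y$ (zero if the boundary directions do not match). * Pop-switch relations: $\uparrow\otimes\downarrow\otimes\circlearrowright$ equals the diagram with the same four boundary points that consists of a cup above a cap, and the same holds with all directions reversed (so with $\downarrow\otimes\uparrow\otimes\circlearrowleft$). * Bubble-bursting relation: $\circlearrowleft+\circlearrowright=(q+q^{-1})\,\epsilon$, where $\epsilon$ is the empty diagram. A non-oriented strand is the sum of its two orientations. Let $[k]=q^{k-1}+q^{k-3}+\dots+q^{1-k}$, let $n\ge 0$, and suppose that $[k]\neq 0$ for $1\le k\le n+2$. Let $p_{m}$ be the Jones–Wenzl idempotent on $m$ non-oriented strands: $p_0=\epsilon$, $p_1$ is one non-oriented strand, and $p_{m+1}=p_m\otimes 1-\frac{[m]}{[m+1]}(p_m\otimes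 1)\,e_m\,(p_m\otimes 1)$ for $m\ge 1$, where $1$ is a non-oriented strand and $e_m$ consists of $m-1$ non-oriented vertical strands followed on the right by a non-oriented cup above a non-oriented cap. Let $\iota_n$ be $n$ vertical strands oriented up, and let $\beta_n$ be $n$ concentric circles oriented counterclockwise; let $\iota_{-n}$ be $n$ vertical strands oriented down, and let $\beta_{-n}$ be $n$ concentric circles oriented clockwise. Let $\cup$ be a cup (a U-shaped arc with two top endpoints) with either of its two orientations, and let $\overline{\cup}$ be the cup with the opposite orientation. Then in $\mathcal{PSPA}$ $$p_{n+2}\,(\iota_n\otimes\cup)=(-1)^{n+1}\,p_{n+2}\,(\overline{\cup}\otimes\iota_n\otimes\beta_n)$$ and $$p_{n+2}\,(\iota_{-n}\otimes\cup)=(-1)^{n+1}\,p_{n+2}\,(\overline{\cup}\otimes\iota_{-n}\otimes\beta_{-n}).$$ -/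

import Mathlib

/-- The direction of an oriented strand where it meets a horizontal line. -/
inductive Dir : Type
  | up
  | down
  deriving DecidableEq

/-- The opposite direction. -/
def Dir.rev : Dir → Dir
  | .up => .down
  | .down => .up

/-- `Diagram u v`: crossingless diagrams of oriented strands in a horizontal strip, cut into
elementary pieces. The directions at the bottom endpoints, from left to right, form the word `u`;
those at the top endpoints form the word `v`. -/
inductive Diagram : List Dir → List Dir → Type
  /-- vertical strands with the given directions; `strands []` is the empty diagram -/
  | strands (w : List Dir) : Diagram w w
  /-- an arc shaped like the letter U: no bottom endpoint, two top endpoints; `d` is the direction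
  at the left one of them -/
  | cup (d : Dir) : Diagram [] [d, d.rev]
  /-- an arc shaped like an upside down U: two bottom endpoints, no top endpoint; `d` is the
  direction at the left one of them -/
  | cap (d : Dir) : Diagram [d, d.rev] []
  /-- `above D E`: `D` is drawn on top of `E` -/
  | above {u v w : List Dir} (D : Diagram v w) (E : Diagram u v) : Diagram u w
  /-- `beside D E`: `D` is drawn to the left of `E` -/
  | beside {u v u' v' : List Dir} (D : Diagram u v) (E : Diagram u' v') :
      Diagram (u ++ u') (v ++ v')

/-- A diagram with arbitrary boundary. -/
abbrev AnyDiagram : Type := Σ u v : List Dir, Diagram u v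

/-- Formal linear combinations of diagrams. Diagrams with different boundaries may be added: this
is the direct sum of the spaces for all pairs of boundary words. -/
abbrev Formal (K : Type*) [Field K] : Type _ := AnyDiagram →₀ K

noncomputable section

namespace Formal

variable {K : Type*} [Field K]

/-- A single diagram, as a linear combination. -/
def of {u v : List Dir} (D : Diagram u v) : Formal K := Finsupp.single ⟨u, v, D⟩ 1

/-- Vertical stacking of two diagrams; it is zero if the boundary words do not match. -/
def stack (D E : AnyDiagram) : Formal K :=
  if h : E.2.1 = D.1 then of (D.2.2.above (h ▸ E.2.2)) else 0

/-- Vertical stacking, extended bilinearly: the first argument is on top. -/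
def above : Formal K →ₗ[K] Formal K →ₗ[K] Formal K :=
  Finsupp.linearCombination K fun D => Finsupp.linearCombination K fun E => stack D E

/-- Horizontal juxtaposition, extended bilinearly: the first argument is on the left. -/
def beside : Formal K →ₗ[K] Formal K →ₗ[K] Formal K :=
  Finsupp.linearCombination K fun D => Finsupp.linearCombination K fun E =>
    of (D.2.2.beside E.2.2)

/-- One vertical strand of direction `d`. -/
def strand (d : Dir) : Formal K := of (.strands [d])

/-- A circle whose left side has direction `d` (so its right side has the opposite direction):
clockwise for `up`, counterclockwise for `down`. -/
def circle (d : Dir) : Formal K := above (of (.cap d)) (of (.cup d))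

/-- The defining local relations. The first group says that diagrams are considered up to planar
isotopy (in the presentation of isotopy classes by elementary pieces: stacking and juxtaposition
are strictly associative and unital, distant pieces can slide past each other vertically, and a
zigzag can be straightened); then come the pop-switch relations and the bubble-bursting
relation. -/
inductive Rel (q : K) : Formal K → Formal K → Prop
  | strands_above {u v : List Dir} (D : Diagram u v) :
      Rel q (of ((Diagram.strands v).above D)) (of D)
  | above_strands {u v : List Dir} (D : Diagram u v) :
      Rel q (of (D.above (Diagram.strands u))) (of D)
  | above_assoc {u v w z : List Dir} (D : Diagram w z) (E : Diagram v w) (F : Diagram u v) :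
      Rel q (of ((D.above E).above F)) (of (D.above (E.above F)))
  | empty_beside {u v : List Dir} (D : Diagram u v) :
      Rel q (of ((Diagram.strands []).beside D)) (of D)
  | beside_empty {u v : List Dir} (D : Diagram u v) :
      Rel q (of (D.beside (Diagram.strands []))) (of D)
  | beside_assoc {u v u' v' u'' v'' : List Dir}
      (D : Diagram u v) (E : Diagram u' v') (F : Diagram u'' v'') :
      Rel q (of ((D.beside E).beside F)) (of (D.beside (E.beside F)))
  | strands_beside (u v : List Dir) :
      Rel q (of ((Diagram.strands u).beside (Diagram.strands v))) (of (Diagram.strands (u ++ v)))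
  | interchange {u v w u' v' w' : List Dir} (D : Diagram v w) (E : Diagram u v)
      (D' : Diagram v' w') (E' : Diagram u' v') :
      Rel q (of ((D.above E).beside (D'.above E'))) (of ((D.beside D').above (E.beside E')))
  | zigzag_left (d : Dir) :
      Rel q (above (beside (of (.cap d)) (strand d)) (beside (strand d) (of (.cup d.rev))))
        (strand d)
  | zigzag_right (d : Dir) :
      Rel q (above (beside (strand d) (of (.cap d.rev))) (beside (of (.cup d)) (strand d)))
        (strand d)
  /-- The two pop-switch relations: an up strand, a down strand and a clockwise circle to the right
  of them equal the cup above the cap with the same four boundary points; and the same with all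
  directions reversed. -/
  | pop_switch (d : Dir) :
      Rel q (beside (beside (strand d) (strand d.rev)) (circle d))
        (above (of (.cup d)) (of (.cap d)))
  | bubble_bursting :
      Rel q (circle .down + circle .up) ((q + q⁻¹) • of (Diagram.strands []))

/-- The planar ideal generated by the local relations: the least subspace that contains them and is
closed under stacking and juxtaposing with anything. As the cups and caps are among the diagrams,
it is also closed under bending endpoints around, hence under every planar operation. -/
def planarIdeal (q : K) : Submodule K (Formal K) :=
  sInf {I | (∀ x y, Rel q x y → x - y ∈ I) ∧
    ∀ x ∈ I, ∀ y, above x y ∈ I ∧ above y x ∈ I ∧ beside x y ∈ I ∧ beside y x ∈ I}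

theorem planarIdeal_closed (q : K) (x : Formal K) (hx : x ∈ planarIdeal q) (y : Formal K) :
    above x y ∈ planarIdeal q ∧ above y x ∈ planarIdeal q ∧
      beside x y ∈ planarIdeal q ∧ beside y x ∈ planarIdeal q := by
  simp only [planarIdeal, Submodule.mem_sInf] at hx ⊢
  exact ⟨fun I hI => (hI.2 x (hx I hI) y).1, fun I hI => (hI.2 x (hx I hI) y).2.1,
    fun I hI => (hI.2 x (hx I hI) y).2.2.1, fun I hI => (hI.2 x (hx I hI) y).2.2.2⟩

end Formal

/-- The pop-switch planar algebra: linear combinations of oriented diagrams modulo planar isotopy,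
the pop-switch relations and the bubble-bursting relation. It is the direct sum of the spaces for
all pairs of boundary words. -/
abbrev PSPA {K : Type*} [Field K] (q : K) : Type _ := Formal K ⧸ Formal.planarIdeal q

namespace PSPA

variable {K : Type*} [Field K] (q : K)

/-- A bilinear operation that preserves the planar ideal, on the quotient. -/
def descend (f : Formal K →ₗ[K] Formal K →ₗ[K] Formal K)
    (hl : ∀ x ∈ Formal.planarIdeal q, ∀ y, f x y ∈ Formal.planarIdeal q)
    (hr : ∀ x ∈ Formal.planarIdeal q, ∀ y, f y x ∈ Formal.planarIdeal q) :
    PSPA q →ₗ[K] PSPA q →ₗ[K] PSPA q :=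
  Submodule.liftQ _
    (LinearMap.flip
      (Submodule.liftQ _ (LinearMap.flip (f.compr₂ (Submodule.mkQ (Formal.planarIdeal q))))
        (fun y hy => by
          rw [LinearMap.mem_ker]
          refine LinearMap.ext fun x => ?_
          exact (Submodule.Quotient.mk_eq_zero _).2 (hr y hy x))))
    (fun x hx => by
      rw [LinearMap.mem_ker]
      refine LinearMap.ext fun y => ?_
      obtain ⟨y, rfl⟩ := Submodule.mkQ_surjective _ y
      exact (Submodule.Quotient.mk_eq_zero _).2 (hl x hx y))

variable {q}

/-- `above x y`: `x` on top of `y`; zero where the boundary words do not match. -/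
def above : PSPA q →ₗ[K] PSPA q →ₗ[K] PSPA q :=
  descend q Formal.above (fun x hx y => (Formal.planarIdeal_closed q x hx y).1)
    (fun x hx y => (Formal.planarIdeal_closed q x hx y).2.1)

/-- `beside x y`: `x` to the left of `y`. -/
def beside : PSPA q →ₗ[K] PSPA q →ₗ[K] PSPA q :=
  descend q Formal.beside (fun x hx y => (Formal.planarIdeal_closed q x hx y).2.2.1)
    (fun x hx y => (Formal.planarIdeal_closed q x hx y).2.2.2)

variable (q)

/-- The class of a diagram. -/
def of {u v : List Dir} (D : Diagram u v) : PSPA q := Submodule.mkQ _ (Formal.of D)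

/-- The empty diagram. -/
def empty : PSPA q := of q (.strands [])

/-- A cup (an arc shaped like the letter U) with direction `d` at its left end. -/
def cup (d : Dir) : PSPA q := of q (.cup d)

/-- A cap (an arc shaped like an upside down U) with direction `d` at its left end. -/
def cap (d : Dir) : PSPA q := of q (.cap d)

/-- A vertical strand of direction `d`. -/
def strand (d : Dir) : PSPA q := of q (.strands [d])

/-- `n` vertical strands of direction `d`: for `up` this is `ι_n`, for `down` it is `ι_{-n}`. -/
def iota (d : Dir) (n : ℕ) : PSPA q := of q (.strands (List.replicate n d))

/-- `n` parallel (that is, concentric) circles whose right sides have direction `d`: for `up` they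
are counterclockwise and form `β_n`, for `down` they are clockwise and form `β_{-n}`. -/
def beta (d : Dir) : ℕ → PSPA q
  | 0 => empty q
  | n + 1 => above (cap q d.rev)
      (above (beside (beside (strand q d.rev) (beta d n)) (strand q d)) (cup q d.rev))

/-- A non-oriented strand, cup or cap is the sum of its two orientations. -/
def ustrand : PSPA q := strand q .up + strand q .down

/-- The non-oriented cup. -/
def ucup : PSPA q := cup q .up + cup q .down

/-- The non-oriented cap. -/
def ucap : PSPA q := cap q .up + cap q .down

/-- `n` vertical non-oriented strands. -/
def ustrands : ℕ → PSPA q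
  | 0 => empty q
  | n + 1 => beside (ustrands n) (ustrand q)

end PSPA

/-- The quantum integer `[k] = q ^ (k - 1) + q ^ (k - 3) + ⋯ + q ^ (1 - k)`. -/
def quantumInt {K : Type*} [Field K] (q : K) (k : ℕ) : K :=
  ∑ i ∈ Finset.range k, q ^ ((k : ℤ) - 1 - 2 * (i : ℤ))

namespace PSPA

variable {K : Type*} [Field K] (q : K)

/-- The Jones-Wenzl idempotent `p_n` on `n` non-oriented strands, by Wenzl's recursion
`p_{n+2} = p_{n+1} ⊗ 1 - ([n+1] / [n+2]) (p_{n+1} ⊗ 1) e_{n+1} (p_{n+1} ⊗ 1)`. -/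
def jonesWenzl : ℕ → PSPA q
  | 0 => empty q
  | 1 => ustrand q
  | n + 2 =>
      beside (jonesWenzl (n + 1)) (ustrand q) -
        (quantumInt q (n + 1) / quantumInt q (n + 2)) •
          above (beside (jonesWenzl (n + 1)) (ustrand q))
            (above (beside (ustrands q n) (above (ucup q) (ucap q)))
              (beside (jonesWenzl (n + 1)) (ustrand q)))

end PSPA

end

/-! Non-oriented strands satisfy the Temperley–Lieb relations with loop value `q + q⁻¹`, so
`p_{n+2}` kills any non-oriented cup below it (`jonesWenzl_above_ucup`). Hence reversing an oriented
cup below `p_{n+2}` costs a sign.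

A pop-switch relation composed with a cup contains a zigzag. Straightening it gives
`cup_strand_circle`: a cup to the right of a strand, with left end opposite to the strand, jumps to
the left of it, is reversed, and leaves a circle on the right of the strand. Undoing the reversal at
the cost of a sign readies the cup for the next strand. After `n` jumps and `n + 1` reversals it
stands at the far left.

What remains is `n` copies of a strand followed by a circle. By `strand_enclose`, a closed diagram
inside a suitably oriented circle on the right of a strand may leave to the left of the strand.
Applied repeatedly to nested circles, this shows that the remaining strands and circles are exactly
`ι_{±n} ⊗ β_{±n}` (`strand_circle_iota_beta`). -/

/-! ### Quantum integers -/

section quantumInt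

variable {K : Type*} [Field K] {q : K}

theorem quantumInt_one : quantumInt q 1 = 1 := by simp [quantumInt]

theorem quantumInt_succ_eq (hq : q ≠ 0) (k : ℕ) :
    quantumInt q (k + 1) = q * quantumInt q k + (q ^ k)⁻¹ := by
  rw [quantumInt, Finset.sum_range_succ, quantumInt, Finset.mul_sum]
  congr 1
  · refine Finset.sum_congr rfl fun i _ => ?_
    rw [← zpow_one_add₀ hq]
    congr 1
    push_cast
    ring
  · rw [← zpow_natCast, ← zpow_neg]
    congr 1
    push_cast
    ring

theorem quantumInt_recurrence (hq : q ≠ 0) (k : ℕ) :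
    quantumInt q (k + 2) + quantumInt q k = (q + q⁻¹) * quantumInt q (k + 1) := by
  rw [quantumInt_succ_eq hq (k + 1), quantumInt_succ_eq hq k, pow_succ]
  field_simp
  ring

end quantumInt

/-! ### Stacking and juxtaposition in the quotient -/

namespace PSPA

variable {K : Type*} [Field K] {q : K}

local notation:70 x:70 " ⊚ " y:71 => above x y
local notation:72 x:72 " ⊠ " y:73 => beside x y

theorem eq_of_rel {x y : Formal K} (h : Formal.Rel q x y) :
    Submodule.mkQ (Formal.planarIdeal q) x = Submodule.mkQ (Formal.planarIdeal q) y := by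
  refine (Submodule.Quotient.eq _).2 ?_
  simp only [Formal.planarIdeal, Submodule.mem_sInf]
  exact fun I hI => hI.1 x y h

theorem mkQ_above (x y : Formal K) :
    Submodule.mkQ (Formal.planarIdeal q) (Formal.above x y) =
      Submodule.mkQ (Formal.planarIdeal q) x ⊚ Submodule.mkQ (Formal.planarIdeal q) y := rfl

theorem mkQ_beside (x y : Formal K) :
    Submodule.mkQ (Formal.planarIdeal q) (Formal.beside x y) =
      Submodule.mkQ (Formal.planarIdeal q) x ⊠ Submodule.mkQ (Formal.planarIdeal q) y := rfl

theorem of_above_of {u v w : List Dir} (D : Diagram v w) (E : Diagram u v) :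
    of q D ⊚ of q E = of q (D.above E) := by
  rw [of, of, ← mkQ_above, of]
  simp [Formal.above, Formal.of, Formal.stack]

theorem of_above_of_ne {u v v' w : List Dir} (D : Diagram v w) (E : Diagram u v') (h : v' ≠ v) :
    of q D ⊚ of q E = 0 := by
  rw [of, of, ← mkQ_above]
  simp [Formal.above, Formal.of, Formal.stack, h]

theorem of_beside_of {u v u' v' : List Dir} (D : Diagram u v) (E : Diagram u' v') :
    of q D ⊠ of q E = of q (D.beside E) := by
  rw [of, of, ← mkQ_beside, of]
  simp [Formal.beside, Formal.of]

variable (q) in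
/-- The span of the diagrams with `m` bottom endpoints and `n` top endpoints. -/
noncomputable def Hom (m n : ℕ) : Submodule K (PSPA q) :=
  Submodule.span K {x | ∃ (u v : List Dir) (D : Diagram u v),
    u.length = m ∧ v.length = n ∧ of q D = x}

theorem of_mem_Hom {m n : ℕ} {u v : List Dir} (D : Diagram u v) (hu : u.length = m)
    (hv : v.length = n) : of q D ∈ Hom q m n :=
  Submodule.subset_span ⟨u, v, D, hu, hv, rfl⟩

theorem induction_of {P : PSPA q → Prop} (hof : ∀ {u v : List Dir} (D : Diagram u v), P (of q D))
    (zero : P 0) (add : ∀ x y, P x → P y → P (x + y)) (smul : ∀ (c : K) x, P x → P (c • x))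
    (x : PSPA q) : P x := by
  obtain ⟨x, rfl⟩ := Submodule.mkQ_surjective _ x
  induction x using Finsupp.induction_linear with
  | zero => simpa using zero
  | add f g hf hg => rw [map_add]; exact add _ _ hf hg
  | single D c =>
    have : (Finsupp.single D c : Formal K) = c • Formal.of D.2.2 := by simp [Formal.of]
    rw [this, map_smul]
    exact smul _ _ (hof _)

theorem Hom_induction {m n : ℕ} {P : (x : PSPA q) → x ∈ Hom q m n → Prop}
    (hof : ∀ {u v : List Dir} (D : Diagram u v) (hu : u.length = m) (hv : v.length = n),
      P (of q D) (of_mem_Hom D hu hv))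
    (zero : P 0 (zero_mem _))
    (add : ∀ x y hx hy, P x hx → P y hy → P (x + y) (add_mem hx hy))
    (smul : ∀ (c : K) x hx, P x hx → P (c • x) (Submodule.smul_mem _ c hx))
    {x : PSPA q} (hx : x ∈ Hom q m n) : P x hx := by
  induction hx using Submodule.span_induction with
  | mem x h => obtain ⟨u, v, D, hu, hv, rfl⟩ := h; exact hof D hu hv
  | zero => exact zero
  | add x y hx hy ihx ihy => exact add x y hx hy ihx ihy
  | smul c x hx ih => exact smul c x hx ih

theorem above_assoc (x y z : PSPA q) : x ⊚ y ⊚ z = x ⊚ (y ⊚ z) := by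
  induction x using induction_of with
  | zero => simp
  | add => simp_all
  | smul => simp_all
  | hof D =>
  induction y using induction_of with
  | zero => simp
  | add => simp_all
  | smul => simp_all
  | hof E =>
  induction z using induction_of with
  | zero => simp
  | add => simp_all
  | smul => simp_all
  | hof F =>
  rename_i v₁ w u₂ v₂ u₃ v₃
  by_cases h₁ : v₂ = v₁ <;> by_cases h₂ : v₃ = u₂ <;> try subst h₁ <;> try subst h₂
  · simp only [of_above_of]
    exact eq_of_rel (.above_assoc D E F)
  · rw [of_above_of, of_above_of_ne _ _ h₂, of_above_of_ne _ _ h₂, map_zero]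
  · subst h₂
    rw [of_above_of, of_above_of_ne _ _ h₁, of_above_of_ne _ _ h₁]
    simp
  · rw [of_above_of_ne _ _ h₂, of_above_of_ne _ _ h₁]
    simp

theorem beside_assoc (x y z : PSPA q) : x ⊠ y ⊠ z = x ⊠ (y ⊠ z) := by
  induction x using induction_of with
  | zero => simp
  | add => simp_all
  | smul => simp_all
  | hof D =>
  induction y using induction_of with
  | zero => simp
  | add => simp_all
  | smul => simp_all
  | hof E =>
  induction z using induction_of with
  | zero => simp
  | add => simp_all
  | smul => simp_all
  | hof F =>
  simp only [of_beside_of]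
  exact eq_of_rel (.beside_assoc D E F)

@[simp]
theorem empty_beside (x : PSPA q) : empty q ⊠ x = x := by
  induction x using induction_of with
  | zero => simp
  | add => simp_all
  | smul => simp_all
  | hof D => exact (of_beside_of _ _).trans (eq_of_rel (.empty_beside D))

@[simp]
theorem beside_empty (x : PSPA q) : x ⊠ empty q = x := by
  induction x using induction_of with
  | zero => simp
  | add => simp_all
  | smul => simp_all
  | hof D => exact (of_beside_of _ _).trans (eq_of_rel (.beside_empty D))

/-- Endpoint counts are what is needed here: non-oriented strands mix boundary words but not their
lengths. Fixing the counts on the left factors forces a matching of the concatenated words to split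
into matchings of both pairs; otherwise both sides vanish. -/
theorem interchange {l m n : ℕ} {x y : PSPA q} (hx : x ∈ Hom q m n) (hy : y ∈ Hom q l m)
    (x' y' : PSPA q) : x ⊠ x' ⊚ (y ⊠ y') = (x ⊚ y) ⊠ (x' ⊚ y') := by
  induction hx using Hom_induction with
  | zero => simp
  | add => simp_all
  | smul => simp_all
  | hof D hDm hDn =>
  induction hy using Hom_induction with
  | zero => simp
  | add => simp_all
  | smul => simp_all
  | hof E hEl hEm =>
  induction x' using induction_of with
  | zero => simp
  | add => simp_all
  | smul => simp_all
  | hof D' =>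
  induction y' using induction_of with
  | zero => simp
  | add => simp_all
  | smul => simp_all
  | hof E' =>
  rename_i v₁ w₁ u₂ v₂ v₃ w₃ u₄ v₄
  simp only [of_beside_of]
  by_cases h : v₂ ++ v₄ = v₁ ++ v₃
  · obtain ⟨rfl, rfl⟩ := List.append_inj h (hEm.trans hDm.symm)
    simp only [of_above_of, of_beside_of]
    exact (eq_of_rel (.interchange D E D' E')).symm
  · rw [of_above_of_ne _ _ h]
    by_cases h₁ : v₂ = v₁
    · have h₂ : v₄ ≠ v₃ := fun h₂ => h (by rw [h₁, h₂])
      rw [of_above_of_ne _ _ h₂, map_zero]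
    · rw [of_above_of_ne _ _ h₁, map_zero, LinearMap.zero_apply]

theorem above_mem {l m n : ℕ} {x y : PSPA q} (hx : x ∈ Hom q m n) (hy : y ∈ Hom q l m) :
    x ⊚ y ∈ Hom q l n := by
  induction hx using Hom_induction with
  | zero => simp
  | add x y _ _ hx hy => simpa using add_mem hx hy
  | smul c x _ hx => simpa using Submodule.smul_mem _ c hx
  | hof D hDm hDn =>
  induction hy using Hom_induction with
  | zero => simp
  | add x y _ _ hx hy => simpa using add_mem hx hy
  | smul c x _ hx => simpa using Submodule.smul_mem _ c hx
  | hof E hEl hEm =>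
  rename_i v w u v'
  by_cases h : v' = v
  · subst h
    rw [of_above_of]
    exact of_mem_Hom _ hEl hDn
  · rw [of_above_of_ne _ _ h]
    exact zero_mem _

theorem beside_mem {m n m' n' : ℕ} {x y : PSPA q} (hx : x ∈ Hom q m n) (hy : y ∈ Hom q m' n') :
    x ⊠ y ∈ Hom q (m + m') (n + n') := by
  induction hx using Hom_induction with
  | zero => simp
  | add x y _ _ hx hy => simpa using add_mem hx hy
  | smul c x _ hx => simpa using Submodule.smul_mem _ c hx
  | hof D hDm hDn =>
  induction hy using Hom_induction with
  | zero => simp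
  | add x y _ _ hx hy => simpa using add_mem hx hy
  | smul c x _ hx => simpa using Submodule.smul_mem _ c hx
  | hof E hEl hEm =>
  rw [of_beside_of]
  exact of_mem_Hom _ (by rw [List.length_append, hDm, hEl]) (by rw [List.length_append, hDn, hEm])

attribute [irreducible] Hom

theorem empty_mem : empty q ∈ Hom q 0 0 := of_mem_Hom (.strands []) rfl rfl
theorem cup_mem (d : Dir) : cup q d ∈ Hom q 0 2 := of_mem_Hom (.cup d) rfl rfl
theorem cap_mem (d : Dir) : cap q d ∈ Hom q 2 0 := of_mem_Hom (.cap d) rfl rfl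
theorem strand_mem (d : Dir) : strand q d ∈ Hom q 1 1 := of_mem_Hom (.strands [d]) rfl rfl
theorem iota_mem (d : Dir) (n : ℕ) : iota q d n ∈ Hom q n n :=
  of_mem_Hom (.strands (List.replicate n d)) List.length_replicate List.length_replicate
theorem ustrand_mem : ustrand q ∈ Hom q 1 1 := add_mem (strand_mem _) (strand_mem _)
theorem ucup_mem : ucup q ∈ Hom q 0 2 := add_mem (cup_mem _) (cup_mem _)
theorem ucap_mem : ucap q ∈ Hom q 2 0 := add_mem (cap_mem _) (cap_mem _)

theorem ustrands_mem (n : ℕ) : ustrands q n ∈ Hom q n n := by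
  induction n with
  | zero => exact empty_mem
  | succ n ih => exact beside_mem ih ustrand_mem

theorem strands_append (u v : List Dir) :
    of q (.strands (u ++ v)) = of q (.strands u) ⊠ of q (.strands v) := by
  rw [of_beside_of]
  exact (eq_of_rel (.strands_beside u v)).symm

theorem strands_above_of {u v : List Dir} (D : Diagram u v) :
    of q (.strands v) ⊚ of q D = of q D := by
  rw [of_above_of]
  exact eq_of_rel (.strands_above D)

theorem of_above_strands {u v : List Dir} (D : Diagram u v) :
    of q D ⊚ of q (.strands u) = of q D := by
  rw [of_above_of]
  exact eq_of_rel (.above_strands D)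

theorem ustrand_above_strand (d : Dir) : ustrand q ⊚ strand q d = strand q d := by
  cases d
  · rw [ustrand, map_add, LinearMap.add_apply, strand, strand, strands_above_of,
      of_above_of_ne _ _ (by decide), add_zero]
  · rw [ustrand, map_add, LinearMap.add_apply, strand, strand, strands_above_of,
      of_above_of_ne _ _ (by decide), zero_add]

theorem strand_above_ustrand (d : Dir) : strand q d ⊚ ustrand q = strand q d := by
  cases d
  · rw [ustrand, map_add, strand, strand, strands_above_of,
      of_above_of_ne _ _ (by decide), add_zero]
  · rw [ustrand, map_add, strand, strand, strands_above_of,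
      of_above_of_ne _ _ (by decide), zero_add]

theorem ustrands_above_strands (v : List Dir) :
    ustrands q v.length ⊚ of q (.strands v) = of q (.strands v) := by
  induction v using List.reverseRecOn with
  | nil => exact strands_above_of _
  | append_singleton v d ih =>
    rw [List.length_append, strands_append, List.length_singleton, ustrands,
      interchange (ustrands_mem _) (of_mem_Hom _ rfl rfl), ih]
    exact congrArg _ (ustrand_above_strand d)

theorem strands_above_ustrands (v : List Dir) :
    of q (.strands v) ⊚ ustrands q v.length = of q (.strands v) := by
  induction v using List.reverseRecOn with
  | nil => exact strands_above_of _
  | append_singleton v d ih =>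
    rw [List.length_append, strands_append, List.length_singleton, ustrands,
      interchange (of_mem_Hom _ rfl rfl) (ustrands_mem _), ih]
    exact congrArg _ (strand_above_ustrand d)

theorem ustrands_above {m n : ℕ} {x : PSPA q} (hx : x ∈ Hom q m n) : ustrands q n ⊚ x = x := by
  induction hx using Hom_induction with
  | zero => simp
  | add => simp_all
  | smul => simp_all
  | hof D hm hn =>
    rw [← strands_above_of D, ← above_assoc, ← hn, ustrands_above_strands]

theorem above_ustrands {m n : ℕ} {x : PSPA q} (hx : x ∈ Hom q m n) : x ⊚ ustrands q m = x := by
  induction hx using Hom_induction with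
  | zero => simp
  | add => simp_all
  | smul => simp_all
  | hof D hm hn =>
    rw [← of_above_strands D, above_assoc, ← hm, strands_above_ustrands]

theorem ustrand_above {m : ℕ} {x : PSPA q} (hx : x ∈ Hom q m 1) : ustrand q ⊚ x = x := by
  simpa [ustrands] using ustrands_above hx

theorem empty_above {m : ℕ} {x : PSPA q} (hx : x ∈ Hom q m 0) : empty q ⊚ x = x :=
  ustrands_above hx

theorem above_empty {n : ℕ} {x : PSPA q} (hx : x ∈ Hom q 0 n) : x ⊚ empty q = x :=
  above_ustrands hx

/-- Two diagrams next to each other can be moved so that the left one is higher. -/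
theorem beside_eq_above_left {m n m' n' : ℕ} {x y : PSPA q} (hx : x ∈ Hom q m n)
    (hy : y ∈ Hom q m' n') : x ⊠ y = x ⊠ ustrands q n' ⊚ (ustrands q m ⊠ y) := by
  rw [interchange hx (ustrands_mem m), above_ustrands hx, ustrands_above hy]

/-- Two diagrams next to each other can be moved so that the right one is higher. -/
theorem beside_eq_above_right {m n m' n' : ℕ} {x y : PSPA q} (hx : x ∈ Hom q m n)
    (hy : y ∈ Hom q m' n') : x ⊠ y = ustrands q n ⊠ y ⊚ (x ⊠ ustrands q m') := by
  rw [interchange (ustrands_mem n) hx, above_ustrands hy, ustrands_above hx]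

/-- An Eckmann–Hilton argument: both sides equal `y` on top of `x`. -/
theorem closed_beside_comm {n : ℕ} {x y : PSPA q} (hx : x ∈ Hom q 0 0) (hy : y ∈ Hom q 0 n) :
    x ⊠ y = y ⊠ x := by
  rw [beside_eq_above_right hx hy, beside_eq_above_left hy hx]
  simp [ustrands]

/-! ### Temperley–Lieb relations for non-oriented strands -/

theorem _root_.Dir.rev_rev (d : Dir) : d.rev.rev = d := by cases d <;> rfl

theorem cap_strand_above_strand_cup (d : Dir) :
    cap q d ⊠ strand q d ⊚ (strand q d ⊠ cup q d.rev) = strand q d :=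
  eq_of_rel (.zigzag_left d)

theorem strand_cap_above_cup_strand (d : Dir) :
    strand q d ⊠ cap q d.rev ⊚ (cup q d ⊠ strand q d) = strand q d :=
  eq_of_rel (.zigzag_right d)

theorem strand_cap_above_cup_strand_eq_zero (a b c d : Dir) (h : [c, c.rev, d] ≠ [a, b, b.rev]) :
    strand q a ⊠ cap q b ⊚ (cup q c ⊠ strand q d) = 0 := by
  rw [strand, strand, cap, cup, of_beside_of, of_beside_of]
  exact of_above_of_ne _ _ h

theorem cap_strand_above_strand_cup_eq_zero (a b c d : Dir) (h : [d, c, c.rev] ≠ [b, b.rev, a]) :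
    cap q b ⊠ strand q a ⊚ (strand q d ⊠ cup q c) = 0 := by
  rw [strand, strand, cap, cup, of_beside_of, of_beside_of]
  exact of_above_of_ne _ _ h

/-- Of all the choices of orientations, only the two consistent ones survive, and each is an
oriented zigzag. -/
theorem ustrand_ucap_above_ucup_ustrand :
    ustrand q ⊠ ucap q ⊚ (ucup q ⊠ ustrand q) = ustrand q := by
  have h₁ := strand_cap_above_cup_strand (q := q) .up
  have h₂ := strand_cap_above_cup_strand (q := q) .down
  simp only [Dir.rev] at h₁ h₂
  simp (discharger := decide) only [ustrand, ucap, ucup, map_add, LinearMap.add_apply,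
    strand_cap_above_cup_strand_eq_zero, h₁, h₂, add_zero, zero_add]

theorem ucap_ustrand_above_ustrand_ucup :
    ucap q ⊠ ustrand q ⊚ (ustrand q ⊠ ucup q) = ustrand q := by
  have h₁ := cap_strand_above_strand_cup (q := q) .up
  have h₂ := cap_strand_above_strand_cup (q := q) .down
  simp only [Dir.rev] at h₁ h₂
  simp (discharger := decide) only [ustrand, ucap, ucup, map_add, LinearMap.add_apply,
    cap_strand_above_strand_cup_eq_zero, h₁, h₂, add_zero, zero_add]
  exact add_comm _ _

variable (q) in
/-- A circle whose left side has direction `d`. -/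
noncomputable def circle (d : Dir) : PSPA q := cap q d ⊚ cup q d

theorem circle_mem (d : Dir) : circle q d ∈ Hom q 0 0 := above_mem (cap_mem d) (cup_mem d)

theorem cap_above_cup_of_ne {c d : Dir} (h : c ≠ d) : cap q c ⊚ cup q d = 0 :=
  of_above_of_ne _ _ (by revert h; cases c <;> cases d <;> decide)

theorem ucap_above_ucup : ucap q ⊚ ucup q = (q + q⁻¹) • empty q := by
  have h : circle q .down + circle q .up = (q + q⁻¹) • empty q := eq_of_rel .bubble_bursting
  rw [← h]
  simp (discharger := decide) only [circle, ucap, ucup, map_add, LinearMap.add_apply,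
    cap_above_cup_of_ne, add_zero, zero_add]
  exact add_comm _ _

/-! ### Jones–Wenzl idempotents and their partial traces -/

theorem jonesWenzl_succ_succ (n : ℕ) : jonesWenzl q (n + 2) =
    jonesWenzl q (n + 1) ⊠ ustrand q - (quantumInt q (n + 1) / quantumInt q (n + 2)) •
      (jonesWenzl q (n + 1) ⊠ ustrand q ⊚ (ustrands q n ⊠ (ucup q ⊚ ucap q) ⊚
        (jonesWenzl q (n + 1) ⊠ ustrand q))) := by
  rw [jonesWenzl]

theorem turnback_mem (n : ℕ) : ustrands q n ⊠ (ucup q ⊚ ucap q) ∈ Hom q (n + 2) (n + 2) :=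
  beside_mem (ustrands_mem n) (above_mem ucup_mem ucap_mem)

theorem jonesWenzl_mem (n : ℕ) : jonesWenzl q n ∈ Hom q n n := by
  induction n using Nat.twoStepInduction with
  | zero => rw [jonesWenzl]; exact empty_mem
  | one => rw [jonesWenzl]; exact ustrand_mem
  | more n _ ih =>
    have h := beside_mem ih ustrand_mem
    rw [jonesWenzl_succ_succ]
    exact sub_mem h (Submodule.smul_mem _ _ 
      (above_mem h (above_mem (turnback_mem n) h)))

theorem ustrands_beside_ucup_above {n : ℕ} {x : PSPA q} (hx : x ∈ Hom q n n) :
    ustrands q n ⊠ ucup q ⊚ x = x ⊠ ucup q := by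
  conv_lhs => rw [← beside_empty x]
  rw [interchange (ustrands_mem n) hx, ustrands_above hx, above_empty ucup_mem]

theorem beside_ustrands_above_ucup {n : ℕ} {x : PSPA q} (hx : x ∈ Hom q n n) :
    x ⊠ ustrand q ⊠ ustrand q ⊚ (ustrands q n ⊠ ucup q) = x ⊠ ucup q := by
  have h : ustrand q ⊠ ustrand q = ustrands q 2 := by simp [ustrands]
  rw [beside_assoc, interchange hx (ustrands_mem n), above_ustrands hx, h,
    ustrands_above ucup_mem]

theorem ucap_above_beside_ustrands {n : ℕ} {x : PSPA q} (hx : x ∈ Hom q n n) :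
    ustrands q n ⊠ ucap q ⊚ (x ⊠ ustrand q ⊠ ustrand q) = x ⊚ (ustrands q n ⊠ ucap q) := by
  have h : ustrand q ⊠ ustrand q = ustrands q 2 := by simp [ustrands]
  conv_rhs => rw [← beside_empty x]
  rw [beside_assoc, interchange (ustrands_mem n) hx, ustrands_above hx, h,
    above_ustrands ucap_mem, interchange hx (ustrands_mem n), above_ustrands hx,
    empty_above ucap_mem]

variable (q) in
/-- The closure of the rightmost strand of a diagram with `n + 1` strands. -/
noncomputable def partialTrace (n : ℕ) (x : PSPA q) : PSPA q :=
  ustrands q n ⊠ ucap q ⊚ (x ⊠ ustrand q) ⊚ (ustrands q n ⊠ ucup q)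

theorem partialTrace_beside_ustrand {n : ℕ} {x : PSPA q} (hx : x ∈ Hom q n n) :
    partialTrace q n (x ⊠ ustrand q) = (q + q⁻¹) • x := by
  rw [partialTrace, above_assoc, beside_ustrands_above_ucup hx,
    interchange (ustrands_mem n) hx, ustrands_above hx, ucap_above_ucup, map_smul, beside_empty]

theorem partialTrace_turnback (n : ℕ) :
    partialTrace q (n + 1) (ustrands q n ⊠ (ucup q ⊚ ucap q)) = ustrands q (n + 1) := by
  have hU := ustrands_mem (q := q) n
  have h1 : ustrand q ⊚ ustrand q = ustrand q := ustrand_above ustrand_mem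
  rw [partialTrace, ustrands, beside_assoc, beside_assoc, beside_assoc, interchange hU hU,
    ustrands_above hU, interchange hU hU, ustrands_above hU]
  congr 1
  conv_lhs => rw [← h1]
  rw [← interchange ucup_mem ucap_mem, ← above_assoc, h1, ustrand_ucap_above_ucup_ustrand,
    above_assoc, ucap_ustrand_above_ustrand_ucup, h1]

theorem partialTrace_sandwich {n : ℕ} {x y z : PSPA q} (hx : x ∈ Hom q n n)
    (hy : y ∈ Hom q (n + 1) (n + 1)) (hz : z ∈ Hom q n n) :
    partialTrace q n (x ⊠ ustrand q ⊚ (y ⊚ (z ⊠ ustrand q))) = x ⊚ (partialTrace q n y ⊚ z) := by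
  have h1 : ustrand q ⊚ ustrand q = ustrand q := ustrand_above ustrand_mem
  have e : (x ⊠ ustrand q ⊚ (y ⊚ (z ⊠ ustrand q))) ⊠ ustrand q =
      x ⊠ ustrand q ⊠ ustrand q ⊚ (y ⊠ ustrand q ⊚ (z ⊠ ustrand q ⊠ ustrand q)) := by
    have hz' := beside_mem hz ustrand_mem
    rw [interchange hy hz', interchange (beside_mem hx ustrand_mem) (above_mem hy hz'), h1, h1]
  rw [partialTrace, e, ← above_assoc, ucap_above_beside_ustrands hx, above_assoc, above_assoc,
    above_assoc, beside_ustrands_above_ucup hz, ← ustrands_beside_ucup_above hz, partialTrace]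
  simp only [above_assoc]

/-- The Jones-Wenzl idempotents absorb their predecessors, are idempotent, have the expected partial
traces, and kill cups. -/
theorem jonesWenzl_aux (hq : q ≠ 0) (n : ℕ)
    (hn : ∀ k : ℕ, 1 ≤ k → k ≤ n + 1 → quantumInt q k ≠ 0) :
    jonesWenzl q (n + 1) ⊚ (jonesWenzl q n ⊠ ustrand q) = jonesWenzl q (n + 1) ∧
    jonesWenzl q (n + 1) ⊚ jonesWenzl q (n + 1) = jonesWenzl q (n + 1) ∧
    partialTrace q n (jonesWenzl q (n + 1)) =
      (quantumInt q (n + 2) / quantumInt q (n + 1)) • jonesWenzl q n ∧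
    ∀ i j, i + 2 + j = n + 1 →
      jonesWenzl q (n + 1) ⊚ (ustrands q i ⊠ ucup q ⊠ ustrands q j) = 0 := by
  induction n with
  | zero =>
    refine ⟨?_, ?_, ?_, fun i j h => by omega⟩
    · simpa [jonesWenzl] using ustrand_above ustrand_mem
    · exact ustrand_above ustrand_mem
    · have h := quantumInt_recurrence hq 0
      have h0 : quantumInt q 0 = 0 := by simp [quantumInt]
      have e : jonesWenzl q (0 + 1) = empty q ⊠ ustrand q := (empty_beside _).symm
      rw [e, partialTrace_beside_ustrand empty_mem]
      simp only [zero_add, quantumInt_one, h0, add_zero, mul_one] at h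
      simp [h, quantumInt_one, jonesWenzl]
  | succ n ih =>
    obtain ⟨ih_absorb, ih_idem, ih_trace, ih_kill⟩ := ih fun k h₁ h₂ => hn k h₁ (by omega)
    have hn₁ : quantumInt q (n + 1) ≠ 0 := hn _ (by omega) (by omega)
    have hn₂ : quantumInt q (n + 2) ≠ 0 := hn _ (by omega) (by omega)
    have hP := jonesWenzl_mem (q := q) (n + 1)
    have hp := jonesWenzl_mem (q := q) n
    have h1 : ustrand q ⊚ ustrand q = ustrand q := ustrand_above ustrand_mem
    have hPP : jonesWenzl q (n + 1) ⊠ ustrand q ⊚ (jonesWenzl q (n + 1) ⊠ ustrand q) =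
        jonesWenzl q (n + 1) ⊠ ustrand q := by
      rw [interchange hP hP, ih_idem, h1]
    have absorb : jonesWenzl q (n + 2) ⊚ (jonesWenzl q (n + 1) ⊠ ustrand q) =
        jonesWenzl q (n + 2) := by
      rw [jonesWenzl_succ_succ, map_sub, LinearMap.sub_apply, map_smul, LinearMap.smul_apply,
        above_assoc, above_assoc, hPP]
    -- For the last cup, the correction term in Wenzl's recursion contains a partial trace of
    -- `p_{n+1}`. Its value `[n+2]/[n+1]` cancels the coefficient `[n+1]/[n+2]`, and the leftover
    -- `p_n` is absorbed.
    have kill : jonesWenzl q (n + 2) ⊚ (ustrands q n ⊠ ucup q) = 0 := by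
      have e : ustrands q n ⊠ (ucup q ⊚ ucap q) =
          ustrands q n ⊠ ucup q ⊚ (ustrands q n ⊠ ucap q) := by
        rw [interchange (ustrands_mem n) (ustrands_mem n), ustrands_above (ustrands_mem n)]
      have t : ustrands q n ⊠ ucap q ⊚ (jonesWenzl q (n + 1) ⊠ ustrand q ⊚
          (ustrands q n ⊠ ucup q)) =
          (quantumInt q (n + 2) / quantumInt q (n + 1)) • jonesWenzl q n := by
        rw [← ih_trace, partialTrace, above_assoc]
      have r : jonesWenzl q (n + 1) ⊠ ustrand q ⊚ (jonesWenzl q n ⊠ ucup q) =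
          jonesWenzl q (n + 1) ⊠ ustrand q ⊚ (ustrands q n ⊠ ucup q) := by
        rw [← beside_ustrands_above_ucup hp, ← above_assoc,
          interchange hP (beside_mem hp ustrand_mem), ih_absorb, h1]
      rw [jonesWenzl_succ_succ, map_sub, LinearMap.sub_apply, map_smul, LinearMap.smul_apply, e,
        above_assoc, above_assoc, above_assoc, t, map_smul, ustrands_beside_ucup_above hp,
        map_smul, r, smul_smul, div_mul_div_cancel₀' hn₁, div_self hn₂, one_smul, sub_self]
    have idem : jonesWenzl q (n + 2) ⊚ jonesWenzl q (n + 2) = jonesWenzl q (n + 2) := by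
      have e : ustrands q n ⊠ (ucup q ⊚ ucap q) =
          ustrands q n ⊠ ucup q ⊚ (ustrands q n ⊠ ucap q) := by
        rw [interchange (ustrands_mem n) (ustrands_mem n), ustrands_above (ustrands_mem n)]
      -- Only the lower factor is expanded: the upper one absorbs `p_{n+1} ⊗ 1` and kills the cup of
      -- the correction term.
      conv_lhs => rhs; rw [jonesWenzl_succ_succ]
      rw [map_sub, map_smul, ← above_assoc, absorb, e, above_assoc (ustrands q n ⊠ ucup q),
        ← above_assoc (jonesWenzl q (n + 2)), kill, map_zero, LinearMap.zero_apply, smul_zero,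
        sub_zero]
    refine ⟨absorb, idem, ?_, ?_⟩
    · have h := quantumInt_recurrence hq (n + 1)
      rw [jonesWenzl_succ_succ]
      have tsub : ∀ (x y : PSPA q) (c : K), partialTrace q (n + 1) (x - c • y) =
          partialTrace q (n + 1) x - c • partialTrace q (n + 1) y := fun x y c => by
        simp [partialTrace]
      rw [tsub, partialTrace_beside_ustrand hP, partialTrace_sandwich hP
        (turnback_mem n) hP, partialTrace_turnback,
        ustrands_above hP, ih_idem, ← sub_smul]
      congr 1
      rw [eq_div_iff hn₂, sub_mul, div_mul_cancel₀ _ hn₂, ← h, add_sub_cancel_right]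
    · rintro i (_ | j) h
      · obtain rfl : i = n := by omega
        simpa [ustrands] using kill
      -- A cup that misses the last strand already dies on the absorbed `p_{n+1}`.
      · rw [← absorb, ustrands, ← beside_assoc, above_assoc,
          interchange hP (m := n + 1) (l := i + j), ih_kill i j (by omega)]
        · simp
        · have := beside_mem (beside_mem (ustrands_mem (q := q) i) ucup_mem) (ustrands_mem j)
          rwa [show i + 2 + j = n + 1 by omega, add_zero] at this

theorem jonesWenzl_above_ucup (hq : q ≠ 0) {n i j : ℕ} (h : i + 2 + j = n)
    (hn : ∀ k : ℕ, 1 ≤ k → k ≤ n → quantumInt q k ≠ 0) :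
    jonesWenzl q n ⊚ (ustrands q i ⊠ ucup q ⊠ ustrands q j) = 0 := by
  obtain ⟨n, rfl⟩ : ∃ m, n = m + 1 := ⟨n - 1, by omega⟩
  exact (jonesWenzl_aux hq n hn).2.2.2 i j h

/-! ### Moving cups across strands -/

theorem strand_above_strand (d : Dir) : strand q d ⊚ strand q d = strand q d :=
  strands_above_of _

theorem strands_above_cup (d : Dir) : strand q d ⊠ strand q d.rev ⊚ cup q d = cup q d := by
  rw [strand, strand, ← strands_append]
  exact strands_above_of _

theorem cap_above_strands (d : Dir) : cap q d ⊚ (strand q d ⊠ strand q d.rev) = cap q d := by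
  rw [strand, strand, ← strands_append]
  exact of_above_strands _

theorem pop_switch (d : Dir) :
    strand q d ⊠ strand q d.rev ⊠ circle q d = cup q d ⊚ cap q d :=
  eq_of_rel (.pop_switch d)

theorem closed_beside_above {c : PSPA q} (hc : c ∈ Hom q 0 0) (x y : PSPA q) :
    c ⊠ (x ⊚ y) = x ⊚ (c ⊠ y) := by
  conv_rhs => lhs; rw [← empty_beside x]
  rw [interchange empty_mem hc, empty_above hc]

theorem above_beside_closed {l m n : ℕ} {c x y : PSPA q} (hc : c ∈ Hom q 0 0)
    (hx : x ∈ Hom q m n) (hy : y ∈ Hom q l m) : (x ⊚ y) ⊠ c = x ⊠ c ⊚ y := by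
  conv_rhs => rhs; rw [← beside_empty y]
  rw [interchange hx hy, above_empty hc]

theorem above_closed {n : ℕ} {c x : PSPA q} (hc : c ∈ Hom q 0 0) (hx : x ∈ Hom q 0 n) :
    x ⊚ c = x ⊠ c := by
  rw [beside_eq_above_left hx hc]
  simp [ustrands]

theorem strand_beside_above (d : Dir) (x y : PSPA q) :
    strand q d ⊠ (x ⊚ y) = strand q d ⊠ x ⊚ (strand q d ⊠ y) := by
  rw [interchange (strand_mem d) (strand_mem d), strand_above_strand]

theorem strand_beside_above_strand (d : Dir) {n : ℕ} {x : PSPA q} (hx : x ∈ Hom q 0 n) :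
    strand q d ⊠ x ⊚ strand q d = strand q d ⊠ x := by
  conv_lhs => rhs; rw [← beside_empty (strand q d)]
  rw [interchange (strand_mem d) (strand_mem d), strand_above_strand, above_empty hx]

/-- Pop-switch applied to the second and third strands puts a cap over the given cup. The two form a
zigzag with the outer strand, and the new cup remains on the right. -/
theorem cup_strand_circle (d : Dir) :
    cup q d ⊠ strand q d ⊠ circle q d.rev = strand q d ⊠ cup q d.rev := by
  have hs := strand_mem (q := q) d
  have h2 := beside_mem hs (strand_mem (q := q) d.rev)
  have e : cup q d ⊠ strand q d =
      strand q d ⊠ strand q d.rev ⊠ strand q d ⊚ (cup q d ⊠ strand q d) := by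
    rw [interchange h2 (cup_mem d), strands_above_cup, strand_above_strand]
  have hp := pop_switch (q := q) d.rev
  rw [Dir.rev_rev] at hp
  have e' : strand q d ⊠ strand q d.rev ⊠ strand q d ⊠ circle q d.rev =
      strand q d ⊠ (cup q d.rev ⊚ cap q d.rev) := by
    rw [← hp]
    simp only [beside_assoc]
  rw [e, above_beside_closed (circle_mem _) (beside_mem h2 hs) (beside_mem (cup_mem d) hs), e',
    strand_beside_above, above_assoc, strand_cap_above_cup_strand,
    strand_beside_above_strand d (cup_mem _)]

/-- The pop-switch relations have their circle on the right. To use one with the circle on the left,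
all endpoints are first bent to the top, where a circle passes freely from one side of the diagram
to the other. -/
theorem circle_beside_strand_cup (d : Dir) :
    circle q d ⊠ (strand q d ⊠ cup q d.rev) = cup q d ⊠ strand q d := by
  have hs := strand_mem (q := q) d
  have hs' := strand_mem (q := q) d.rev
  have hss := beside_mem hs hs'
  have hu := cup_mem (q := q) d
  have hc := circle_mem (q := q) d
  have hcup := strands_above_cup (q := q) d.rev
  have hcap := cap_above_strands (q := q) d.rev
  have hzz := strand_cap_above_cup_strand (q := q) d.rev
  rw [Dir.rev_rev] at hcup hcap hzz
  -- `M` consists of two nested cups. It is `strand q d ⊠ cup q d.rev` with the bottom endpoint bent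
  -- up to the far right.
  obtain ⟨M, hM⟩ : ∃ M : PSPA q, M = strand q d ⊠ (cup q d.rev ⊠ strand q d.rev) ⊚ cup q d :=
    ⟨_, rfl⟩
  have hM_mem : M ∈ Hom q 0 4 := by
    rw [hM]
    exact above_mem (beside_mem hs (beside_mem (cup_mem d.rev) hs')) hu
  have hM_strands : strand q d ⊠ strand q d.rev ⊠ (strand q d ⊠ strand q d.rev) ⊚ M = M := by
    rw [hM, ← above_assoc, beside_assoc, interchange hs hs, ← beside_assoc (strand q d.rev),
      interchange (beside_mem hs' hs) (cup_mem _), hcup, strand_above_strand, strand_above_strand]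
  have hM_cap : strand q d ⊠ strand q d.rev ⊠ cap q d ⊚ M = cup q d := by
    rw [hM, ← above_assoc, beside_assoc, interchange hs hs, hzz, strand_above_strand,
      strands_above_cup]
  -- Pop-switch on the two rightmost legs turns the nested cups into adjacent ones.
  have hM_circle : M ⊠ circle q d = cup q d ⊠ cup q d := by
    have e : strand q d ⊠ strand q d.rev ⊠ (cup q d ⊚ cap q d) =
        strand q d ⊠ strand q d.rev ⊠ cup q d ⊚ (strand q d ⊠ strand q d.rev ⊠ cap q d) := by
      rw [interchange hss hss, interchange hs hs, strand_above_strand, strand_above_strand]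
    conv_lhs => rw [← hM_strands]
    rw [above_beside_closed hc (beside_mem hss hss) hM_mem,
      beside_assoc _ (strand q d ⊠ strand q d.rev), pop_switch, e, above_assoc, hM_cap]
    conv_lhs => rhs; rw [← beside_empty (cup q d)]
    rw [interchange hss hu, strands_above_cup, above_empty hu]
  -- Bending the rightmost endpoint back down recovers the strand beside the inner cup.
  have hM_bend : strand q d ⊠ cup q d.rev =
      strand q d ⊠ strand q d.rev ⊠ (strand q d ⊠ cap q d.rev) ⊚ (M ⊠ strand q d) := by
    have h3 := beside_mem hs (beside_mem hs' hs)
    have e₁ : M ⊠ strand q d = strand q d ⊠ cup q d.rev ⊠ (strand q d.rev ⊠ strand q d) ⊚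
        (cup q d ⊠ strand q d) := by
      conv_lhs => rhs; rw [← strand_above_strand]
      rw [hM, ← interchange (beside_mem hs (beside_mem (cup_mem d.rev) hs')) hu]
      simp only [beside_assoc]
    have e₂ : strand q d ⊠ strand q d.rev ⊠ (strand q d ⊠ cap q d.rev) ⊚
        (strand q d ⊠ cup q d.rev ⊠ (strand q d.rev ⊠ strand q d)) =
        strand q d ⊠ cup q d.rev ⊚ (strand q d ⊠ cap q d.rev) := by
      conv_rhs => lhs; rw [← beside_empty (strand q d ⊠ cup q d.rev)]
      rw [interchange (beside_mem hs (cup_mem d.rev)) hs, strand_beside_above_strand d (cup_mem _),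
        empty_above (cap_mem _), ← beside_assoc, beside_assoc (strand q d),
        interchange h3 (beside_mem hs (cup_mem d.rev)), hcap, interchange hs hs, hcup,
        strand_above_strand]
    rw [e₁, ← above_assoc, e₂, above_assoc, strand_cap_above_cup_strand,
      strand_beside_above_strand d (cup_mem _)]
  rw [hM_bend, closed_beside_above hc, ← beside_assoc (circle q d) M, closed_beside_comm hc hM_mem,
    hM_circle, beside_assoc (cup q d), interchange hss hu, strands_above_cup,
    strand_cap_above_cup_strand]

/-! ### Opening nested circles next to a strand -/

variable (q) in
/-- A closed diagram with a circle around it whose right side has direction `d`. -/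
noncomputable def enclose (d : Dir) (x : PSPA q) : PSPA q :=
  cap q d.rev ⊚ (strand q d.rev ⊠ x ⊠ strand q d ⊚ cup q d.rev)

theorem enclose_mem (d : Dir) {x : PSPA q} (hx : x ∈ Hom q 0 0) : enclose q d x ∈ Hom q 0 0 :=
  above_mem (cap_mem _) (above_mem (beside_mem (beside_mem (strand_mem _) hx) (strand_mem _))
    (cup_mem _))

theorem enclose_empty (d : Dir) : enclose q d (empty q) = circle q d.rev := by
  have h := strands_above_cup (q := q) d.rev
  rw [Dir.rev_rev] at h
  rw [enclose, beside_empty, h, circle]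

theorem beta_succ (d : Dir) (n : ℕ) : beta q d (n + 1) = enclose q d (beta q d n) := rfl

theorem beta_mem (d : Dir) (n : ℕ) : beta q d n ∈ Hom q 0 0 := by
  induction n with
  | zero => exact empty_mem
  | succ n ih => exact enclose_mem d ih

/-- The circle on the left trades the bottom arc of the enclosing circle for a cup on the left of
the strand. The curve becomes a zigzag, and `x` lies in the region to its left. -/
theorem circle_strand_enclose (d : Dir) {x : PSPA q} (hx : x ∈ Hom q 0 0) :
    circle q d ⊠ strand q d ⊠ enclose q d x = x ⊠ strand q d := by
  have hs := strand_mem (q := q) d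
  have hs' := strand_mem (q := q) d.rev
  have hc := circle_mem (q := q) d
  have h : strand q d ⊠ (strand q d.rev ⊠ x ⊠ strand q d) ⊚ (cup q d ⊠ strand q d) =
      cup q d ⊠ strand q d ⊚ (x ⊠ strand q d) := by
    have e : x ⊠ strand q d ⊚ strand q d = x ⊠ strand q d := by
      conv_lhs => rhs; rw [← empty_beside (strand q d)]
      rw [interchange hx empty_mem, above_empty hx, strand_above_strand]
    rw [interchange (cup_mem d) hx, above_closed hx (cup_mem d), strand_above_strand,
      beside_assoc (strand q d.rev), ← beside_assoc (strand q d),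
      interchange (beside_mem hs hs') (cup_mem d), strands_above_cup, e, beside_assoc]
  rw [beside_assoc, enclose, strand_beside_above, strand_beside_above, closed_beside_above hc,
    closed_beside_above hc, circle_beside_strand_cup, h, ← above_assoc,
    strand_cap_above_cup_strand, ← closed_beside_above hx, strand_above_strand]

/-- For empty `x`, `circle_strand_enclose` says that `circle q d` on the left of the strand and
`circle q d.rev` on the right cancel. This pair is used to move the extra circle to the other side.
-/
theorem strand_enclose (d : Dir) {x : PSPA q} (hx : x ∈ Hom q 0 0) :
    strand q d ⊠ enclose q d x = x ⊠ strand q d ⊠ circle q d.rev := by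
  rw [← circle_strand_enclose d hx, beside_assoc (circle q d ⊠ strand q d),
    closed_beside_comm (enclose_mem d hx) (circle_mem _), ← beside_assoc]
  have h := circle_strand_enclose (q := q) d empty_mem
  rw [enclose_empty, empty_beside] at h
  rw [h]

theorem iota_succ (d : Dir) (n : ℕ) : iota q d (n + 1) = iota q d n ⊠ strand q d := by
  rw [iota, List.replicate_succ', strands_append]
  rfl

/-- By `strand_enclose`, the outermost circle opens at the rightmost strand and releases the inner
circles to the left of it. Thus `iota q d n ⊠ beta q d n` is the `n`-fold product of a strand
followed by a circle, and a further factor may be added at either end. -/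
theorem strand_circle_iota_beta (d : Dir) (n : ℕ) :
    strand q d ⊠ circle q d.rev ⊠ (iota q d n ⊠ beta q d n) =
      iota q d (n + 1) ⊠ beta q d (n + 1) := by
  induction n with
  | zero =>
    rw [beta_succ, beta, enclose_empty, beside_empty, iota_succ]
    have h0 : iota q d 0 = empty q := rfl
    rw [h0, beside_empty, empty_beside]
  | succ n ih =>
    rw [beta_succ d n, iota_succ d n, beside_assoc (iota q d n), strand_enclose d (beta_mem d n),
      ← beside_assoc (iota q d n), ← beside_assoc (iota q d n), ← beside_assoc, ← beside_assoc,
      ih, iota_succ d (n + 1), beta_succ d (n + 1), beside_assoc (iota q d (n + 1)) (strand q d),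
      strand_enclose d (beta_mem d _)]
    simp only [beside_assoc]

/-! ### Carrying the cup through the strands -/

theorem ucup_eq (d : Dir) : ucup q = cup q d + cup q d.rev := by
  cases d
  · rfl
  · exact add_comm _ _

theorem jonesWenzl_above_cup_rev (hq : q ≠ 0) {n i j : ℕ} (h : i + 2 + j = n)
    (hn : ∀ k : ℕ, 1 ≤ k → k ≤ n → quantumInt q k ≠ 0) (d : Dir) {x y : PSPA q}
    (hx : x ∈ Hom q i i) (hy : y ∈ Hom q j j) :
    jonesWenzl q n ⊚ (x ⊠ cup q d ⊠ y) = -(jonesWenzl q n ⊚ (x ⊠ cup q d.rev ⊠ y)) := by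
  have e : ustrands q i ⊠ ucup q ⊠ ustrands q j ⊚ (x ⊠ y) = x ⊠ ucup q ⊠ y := by
    conv_lhs => rhs; lhs; rw [← beside_empty x]
    rw [interchange (beside_mem (ustrands_mem i) ucup_mem) (beside_mem hx empty_mem),
      interchange (ustrands_mem i) hx, ustrands_above hx, ustrands_above hy,
      above_empty ucup_mem]
  rw [eq_neg_iff_add_eq_zero, ← map_add, ← LinearMap.add_apply, ← map_add, ← map_add, ← ucup_eq,
    ← e, ← above_assoc, jonesWenzl_above_ucup hq h hn, map_zero, LinearMap.zero_apply]

/-- The intermediate state of the walk: `i` strands are still to be crossed, and the `j` crossed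
ones have already gathered their circles. -/
theorem jonesWenzl_above_iota_cup (hq : q ≠ 0) {n i j : ℕ} (h : i + j = n)
    (hn : ∀ k : ℕ, 1 ≤ k → k ≤ n + 2 → quantumInt q k ≠ 0) (d : Dir) :
    jonesWenzl q (n + 2) ⊚ (iota q d i ⊠ cup q d.rev ⊠ (iota q d j ⊠ beta q d j)) =
      (-1 : K) ^ (i + 1) •
        (jonesWenzl q (n + 2) ⊚ (cup q d ⊠ (iota q d n ⊠ beta q d n))) := by
  have hZ (j : ℕ) : iota q d j ⊠ beta q d j ∈ Hom q j j := beside_mem (iota_mem d j) (beta_mem d j)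
  induction i generalizing j with
  | zero =>
    obtain rfl : j = n := by omega
    -- One final reversal accounts for the extra sign in `i + 1`.
    rw [jonesWenzl_above_cup_rev hq (by omega) hn _ (iota_mem d 0) (hZ j), Dir.rev_rev]
    simp [show iota q d 0 = empty q from rfl]
  | succ i ih =>
    rw [iota_succ, beside_assoc (iota q d i), ← cup_strand_circle, beside_assoc (cup q d),
      ← beside_assoc (iota q d i), beside_assoc (iota q d i ⊠ cup q d), strand_circle_iota_beta,
      jonesWenzl_above_cup_rev hq (by omega) hn _ (iota_mem d i) (hZ _), ih (by omega),
      pow_succ _ (i + 1)]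
    simp

theorem jonesWenzl_iota_cup (hq : q ≠ 0) {n : ℕ}
    (hn : ∀ k : ℕ, 1 ≤ k → k ≤ n + 2 → quantumInt q k ≠ 0) (d a : Dir) :
    jonesWenzl q (n + 2) ⊚ (iota q d n ⊠ cup q a) =
      (-1 : K) ^ (n + 1) •
        (jonesWenzl q (n + 2) ⊚ (cup q a.rev ⊠ iota q d n ⊠ beta q d n)) := by
  have hZ : iota q d n ⊠ beta q d n ∈ Hom q n n := beside_mem (iota_mem d n) (beta_mem d n)
  have h := jonesWenzl_above_iota_cup hq (add_zero n) hn d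
  have h0 : iota q d 0 ⊠ beta q d 0 = empty q := empty_beside _
  rw [h0, beside_empty] at h
  obtain rfl | rfl : a = d.rev ∨ a = d := by cases a <;> cases d <;> simp [Dir.rev]
  · rw [h, Dir.rev_rev, beside_assoc]
  -- A cup of the other orientation cannot jump directly. Reversing the cups on both sides reduces
  -- to the previous case, and the two signs cancel.
  · have h₁ := jonesWenzl_above_cup_rev hq (i := n) (j := 0) rfl hn a (iota_mem a n) empty_mem
    have h₂ := jonesWenzl_above_cup_rev hq (i := 0) (j := n) (by omega) hn a empty_mem hZ
    simp only [beside_empty, empty_beside] at h₁ h₂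
    rw [h₁, h, h₂, beside_assoc]
    simp

end PSPA

theorem mainTheorem1 {K : Type*} [Field K] (q : K) (hq : q ≠ 0) (n : ℕ)
    (hn : ∀ k : ℕ, 1 ≤ k → k ≤ n + 2 → quantumInt q k ≠ 0) (a : Dir) :
    PSPA.above (PSPA.jonesWenzl q (n + 2))
          (PSPA.beside (PSPA.iota q Dir.up n) (PSPA.cup q a)) =
        (-1 : K) ^ (n + 1) • PSPA.above (PSPA.jonesWenzl q (n + 2))
          (PSPA.beside (PSPA.beside (PSPA.cup q a.rev) (PSPA.iota q Dir.up n))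
            (PSPA.beta q Dir.up n)) ∧
      PSPA.above (PSPA.jonesWenzl q (n + 2))
          (PSPA.beside (PSPA.iota q Dir.down n) (PSPA.cup q a)) =
        (-1 : K) ^ (n + 1) • PSPA.above (PSPA.jonesWenzl q (n + 2))
          (PSPA.beside (PSPA.beside (PSPA.cup q a.rev) (PSPA.iota q Dir.down n))
            (PSPA.beta q Dir.down n)) :=
  ⟨PSPA.jonesWenzl_iota_cup hq hn .up a, PSPA.jonesWenzl_iota_cup hq hn .down a⟩
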